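/- Let $M\subset\mathbb{R}^N$ be a smooth $m$-dimensional submanifold, oriented by a continuous field $\mathfrak{T}:M\to\bigwedge_m\mathbb{R}^N$ of unit $m$-blades $\mathfrak{T}(x)=\tau_1\wedge\dots\wedge\tau_m$, where $\tau_1,\dots,\tau_m$ is an orthonormal basis of $T_xM$ (the Gauss map of $M$). Let $\mathcal{N}=\star\mathfrak{T}=\mathfrak{T}^{\mathbf t}\lrcorner(e_1\wedge\dots\wedge e_N)$ be the normal Gauss map, where $\star$ is the Hodge dual, $(\cdot)^{\mathbf t}$ the reversion and $\lrcorner$ the left contraction of multivectors, and let $H:M\to\mathbb{R}^N$ be the mean curvature vector field, i.e. the trace $H(x)=\sum_{j=1}^m \mathrm{II}_x(\tau_j,\tau_j)$ of the second fundamental form. For a function $F:M\to\bigwedge_*\mathbb{R}^N$, denote by $D_{a}F$ its directional derivative in a tangent direction $a$ and put, for any orthonormal basis $\tau_1,\dots,\tau_m$ of $T_xM$, $$\partial\lrcorner F=\sum_{j=1}^m\tau_j\lrcorner D_{\tau_j}F,\qquad \partial\wedge F=\sum_{j=1}^m\tau_j\wedge D_{\tau_j}F,\qquad \diamondsuit F=\partial\lrcorner(\partial\wedge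 F)+\partial\wedge(\partial\lrcorner F).$$ Then $H$ is curl-free, i.e. $\partial\wedge H\equiv0$ on $M$, if and only if the Gauss map is graded-harmonic, i.e. $\diamondsuit\mathfrak{T}\equiv0$ on $M$. Likewise, $\partial\wedge H\equiv 0$ on $M$ if and only if $\diamondsuit\mathcal{N}\equiv0$ on $M$. -/

import Mathlib

open scoped ContDiff Topology

noncomputable section

namespace GaussMap

/-- The Euclidean vector space `ℝ^N`. -/
abbrev Euc (N : ℕ) : Type := EuclideanSpace ℝ (Fin N)

/-- The multivectors `⋀_* ℝ^N`. Multiplication in this algebra is the exterior product. -/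
abbrev Multivector (N : ℕ) : Type := ExteriorAlgebra ℝ (Euc N)

section Algebra

variable {N : ℕ}

/-- A vector, viewed as a multivector of grade one. -/
abbrev vec (N : ℕ) : Euc N →ₗ[ℝ] Multivector N := ExteriorAlgebra.ι ℝ

/-- The coordinates of a multivector with respect to the basis `e_I = e_{i_1} ∧ … ∧ e_{i_r}`,
`I = {i_1 < … < i_r}`, induced by the standard basis of `ℝ^N`. -/
def coords (N : ℕ) : Multivector N ≃ₗ[ℝ] EuclideanSpace ℝ (Finset (Fin N)) :=
  ((EuclideanSpace.basisFun (Fin N) ℝ).toBasis.ExteriorAlgebra.equivFun).trans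
    (WithLp.linearEquiv 2 ℝ (Finset (Fin N) → ℝ)).symm

/-- The norm on multivectors for which the `e_I` are orthonormal. -/
instance : NormedAddCommGroup (Multivector N) :=
  NormedAddCommGroup.induced (Multivector N) (EuclideanSpace ℝ (Finset (Fin N)))
    (coords N) (coords N).injective

instance : NormedSpace ℝ (Multivector N) :=
  NormedSpace.induced ℝ (Multivector N) (EuclideanSpace ℝ (Finset (Fin N))) (coords N)

/-- The left contraction `a ⌟ B` of a multivector `B` by a vector `a`, i.e. the antiderivation of
the exterior algebra with `a ⌟ b = ⟪a, b⟫` for vectors `b`. -/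
def vecContract (N : ℕ) : Euc N →ₗ[ℝ] Module.End ℝ (Multivector N) :=
  (CliffordAlgebra.contractLeft (Q := (0 : QuadraticForm ℝ (Euc N)))).comp (innerₗ (Euc N))

/-- The left contraction `A ⌟ B` of multivectors; as an algebra homomorphism in `A`, it satisfies
`(A ∧ B) ⌟ C = A ⌟ (B ⌟ C)`. -/
def leftContract (N : ℕ) : Multivector N →ₐ[ℝ] Module.End ℝ (Multivector N) :=
  ExteriorAlgebra.lift ℝ ⟨vecContract N, fun _ =>
    LinearMap.ext fun B => CliffordAlgebra.contractLeft_contractLeft _ B⟩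

/-- The unit pseudoscalar `i = e_1 ∧ … ∧ e_N`. -/
def pseudoscalar (N : ℕ) : Multivector N :=
  ExteriorAlgebra.ιMulti ℝ N fun i => EuclideanSpace.single i (1 : ℝ)

/-- The Hodge dual `⋆A = Aᵗ ⌟ i`, where `Aᵗ` is the reversion of `A`. -/
def hodgeDual (A : Multivector N) : Multivector N :=
  leftContract N (CliffordAlgebra.reverse (Q := (0 : QuadraticForm ℝ (Euc N))) A) (pseudoscalar N)

end Algebra

section Submanifold

variable {N : ℕ}

/-- `M ⊂ ℝ^N` is an `m`-dimensional smooth (embedded) submanifold: near each of its points, some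
smooth diffeomorphism between open subsets of `ℝ^N` takes `M` to an `m`-dimensional linear
subspace. -/
def IsSmoothSubmanifold (m : ℕ) (M : Set (Euc N)) : Prop :=
  ∀ x ∈ M, ∃ (W : Submodule ℝ (Euc N)) (Φ : OpenPartialHomeomorph (Euc N) (Euc N)),
    Module.finrank ℝ W = m ∧ x ∈ Φ.source ∧
    ContDiffOn ℝ ∞ Φ Φ.source ∧ ContDiffOn ℝ ∞ Φ.symm Φ.target ∧
    ∀ y ∈ Φ.source, y ∈ M ↔ Φ y ∈ W

/-- `γ` is a curve in `M` through `γ 0 = x` with velocity `γ' 0 = a`. -/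
def IsCurveThrough (M : Set (Euc N)) (x a : Euc N) (γ : ℝ → Euc N) : Prop :=
  γ 0 = x ∧ (∀ᶠ t in 𝓝 (0 : ℝ), γ t ∈ M) ∧ HasDerivAt γ a 0

/-- The tangent space `T_x M`, spanned by the velocities of the curves in `M` through `x` (for a
submanifold, these velocities already form a linear subspace). -/
def tangentSpace (M : Set (Euc N)) (x : Euc N) : Submodule ℝ (Euc N) :=
  Submodule.span ℝ {a | ∃ γ, IsCurveThrough M x a γ}

/-- The directional derivative at `x ∈ M`, in the direction of a tangent vector `a`, of a function
`F` on `M` (the values of `F` outside `M` play no role). -/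
def dirDeriv {V : Type*} [NormedAddCommGroup V] [NormedSpace ℝ V]
    (M : Set (Euc N)) (F : Euc N → V) (x a : Euc N) : V :=
  fderivWithin ℝ F M x a

/-- The directional derivative is the derivative of `F` along the curves in `M` with velocity
`a`. -/
theorem hasDerivAt_comp_curve {V : Type*} [NormedAddCommGroup V] [NormedSpace ℝ V]
    {M : Set (Euc N)} {F : Euc N → V} {x a : Euc N} {γ : ℝ → Euc N}
    (hF : DifferentiableWithinAt ℝ F M x) (hγ : IsCurveThrough M x a γ) :
    HasDerivAt (fun t => F (γ t)) (dirDeriv M F x a) 0 := by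
  obtain ⟨h0, hM, hd⟩ := hγ
  subst h0
  have h1 : HasFDerivAt γ (ContinuousLinearMap.toSpanSingleton ℝ a) 0 := hd.hasFDerivAt
  have h2 : HasFDerivWithinAt γ (ContinuousLinearMap.toSpanSingleton ℝ a) (γ ⁻¹' M) 0 :=
    h1.hasFDerivWithinAt
  have h3 := hF.hasFDerivWithinAt.comp (0 : ℝ) h2 (Set.mapsTo_preimage γ M)
  have h4 := h3.hasFDerivAt hM
  simpa [dirDeriv, Function.comp_def] using h4.hasDerivAt

/-- An orthonormal frame `τ_1, …, τ_r`, `r = dim T_x M`, of `T_x M`. -/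
def frame (M : Set (Euc N)) (x : Euc N) :
    OrthonormalBasis (Fin (Module.finrank ℝ (tangentSpace M x))) ℝ (tangentSpace M x) :=
  stdOrthonormalBasis ℝ (tangentSpace M x)

/-- The divergence `∂ ⌟ F = ∑ j, τ_j ⌟ (τ_j · ∂) F` of a multivector-valued function on `M`. -/
def divergence (M : Set (Euc N)) (F : Euc N → Multivector N) (x : Euc N) : Multivector N :=
  ∑ j, vecContract N (frame M x j) (dirDeriv M F x (frame M x j))

/-- The curl `∂ ∧ F = ∑ j, τ_j ∧ (τ_j · ∂) F` of a multivector-valued function on `M`. -/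
def curl (M : Set (Euc N)) (F : Euc N → Multivector N) (x : Euc N) : Multivector N :=
  ∑ j, vec N (frame M x j) * dirDeriv M F x (frame M x j)

/-- The graded Laplace operator `◇F = ∂ ⌟ (∂ ∧ F) + ∂ ∧ (∂ ⌟ F)`. -/
def gradedLaplacian (M : Set (Euc N)) (F : Euc N → Multivector N) (x : Euc N) : Multivector N :=
  divergence M (curl M F) x + curl M (divergence M F) x

/-- `F` is curl-free on `M`. -/
def IsCurlFree (M : Set (Euc N)) (F : Euc N → Multivector N) : Prop :=
  ∀ x ∈ M, curl M F x = 0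

/-- `F` is graded-harmonic on `M`. -/
def IsGradedHarmonic (M : Set (Euc N)) (F : Euc N → Multivector N) : Prop :=
  ∀ x ∈ M, gradedLaplacian M F x = 0

/-- The second fundamental form of `M` at `x`, for tangent vectors `a`, `b`: the normal part of the
directional derivative, in the direction `a`, of the tangent vector field `y ↦ P_y b`, which
extends `b`. Here `P_y` is the orthogonal projection onto `T_y M`. -/
def secondFundamentalForm (M : Set (Euc N)) (x a b : Euc N) : Euc N :=
  (tangentSpace M x)ᗮ.starProjection
    (dirDeriv M (fun y => (tangentSpace M y).starProjection b) x a)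

/-- The mean curvature vector `H`, the trace of the second fundamental form. -/
def meanCurvature (M : Set (Euc N)) (x : Euc N) : Euc N :=
  ∑ j, secondFundamentalForm M x (frame M x j) (frame M x j)

/-- `T` is the Gauss map of `M` for one of its orientations: a continuous field on `M` of unit
`m`-blades `τ_1 ∧ … ∧ τ_m`, with `τ_1, …, τ_m` an orthonormal frame of the tangent space. -/
structure IsGaussMap (m : ℕ) (M : Set (Euc N)) (T : Euc N → Multivector N) : Prop where
  continuousOn : ContinuousOn T M
  eq_blade : ∀ x ∈ M, ∃ τ : OrthonormalBasis (Fin m) ℝ (tangentSpace M x),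
    T x = ExteriorAlgebra.ιMulti ℝ m fun j => (τ j : Euc N)

/-- The normal Gauss map, the Hodge dual `⋆T` of the Gauss map `T`. -/
def normalGaussMap (T : Euc N → Multivector N) (x : Euc N) : Multivector N :=
  hodgeDual (T x)

end Submanifold

end GaussMap

end

/-! Let `P_y` be the orthogonal projection onto `T_y M`. For tangent `a`, `b`, the derivative `P'_a
b` is normal (differentiate `P P b = P b`) and symmetric in `a`, `b`; it is the second fundamental
form `II(a, b)`. Since `T` is locally the normalized image of a fixed blade under `P`, `D_a T = ∑
II(a, τ_k) ∧ (τ_k ⌟ T)`. As `τ_j ∧ (τ_k ⌟ T) = δ_jk T`, this gives `∂ ∧ T = -H ∧ T`, while `∂ ⌟ T =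
0` because a symmetric factor meets an antisymmetric one.

Hence `◇T = -∂ ⌟ (H ∧ T) = ∑ (D_j H ∧ (τ_j ⌟ T) - ⟪τ_j, D_j H⟫ T)`, where `D_j` is the derivative
along `τ_j`. Tangential parts of `D_j H` cancel in each summand, and the normal parts contribute
independently, so `◇T = 0` exactly when every `D_j H` is tangent. On the other side `⟪τ_k, D_j H⟫ =
-⟪II(τ_j, τ_k), H⟫` is symmetric, so the tangential parts also drop out of `∂ ∧ H = ∑ τ_j ∧ D_j H`,
which therefore vanishes under the same condition.

For the normal Gauss map, `⋆` interchanges divergence and curl up to signs and grade involution;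
these cancel in `◇`, so `◇⋆T = ⋆◇T`, and `⋆` is injective. -/

noncomputable section

namespace GaussMap

/-! ### Contraction and exterior multiplication by vectors; orthonormal blades. -/

section MultivectorAlgebra

variable {N : ℕ}

instance : FiniteDimensional ℝ (Multivector N) :=
  LinearEquiv.finiteDimensional (coords N).symm

/-- Induction on multivectors, multiplying by vectors from the left. -/
theorem multivector_left_induction {C : Multivector N → Prop}
    (algebraMap : ∀ r : ℝ, C (algebraMap ℝ (Multivector N) r))
    (add : ∀ A B, C A → C B → C (A + B))
    (vec_mul : ∀ b A, C A → C (vec N b * A)) (A : Multivector N) : C A :=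
  CliffordAlgebra.left_induction (0 : QuadraticForm ℝ (Euc N)) algebraMap add
    (fun A b h => vec_mul b A h) A

/-- Induction on multivectors, multiplying by vectors from the right. -/
theorem multivector_right_induction {C : Multivector N → Prop}
    (algebraMap : ∀ r : ℝ, C (algebraMap ℝ (Multivector N) r))
    (add : ∀ A B, C A → C B → C (A + B))
    (mul_vec : ∀ b A, C A → C (A * vec N b)) (A : Multivector N) : C A :=
  CliffordAlgebra.right_induction (0 : QuadraticForm ℝ (Euc N)) algebraMap add
    (fun b A h => mul_vec b A h) A

/-- The grade involution. -/
def gradeInvol (N : ℕ) : Multivector N →ₐ[ℝ] Multivector N :=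
  CliffordAlgebra.involute (Q := (0 : QuadraticForm ℝ (Euc N)))

/-- The reversion. -/
def reversion (N : ℕ) : Multivector N →ₗ[ℝ] Multivector N :=
  CliffordAlgebra.reverse (Q := (0 : QuadraticForm ℝ (Euc N)))

theorem gradeInvol_vec (a : Euc N) : gradeInvol N (vec N a) = -vec N a :=
  CliffordAlgebra.involute_ι a

theorem gradeInvol_gradeInvol (A : Multivector N) : gradeInvol N (gradeInvol N A) = A :=
  CliffordAlgebra.involute_involute A

theorem reversion_vec (a : Euc N) : reversion N (vec N a) = vec N a :=
  CliffordAlgebra.reverse_ι a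

theorem reversion_mul (A B : Multivector N) :
    reversion N (A * B) = reversion N B * reversion N A :=
  CliffordAlgebra.reverse.map_mul A B

theorem reversion_one : reversion N 1 = 1 :=
  CliffordAlgebra.reverse.map_one

theorem vecContract_vec_mul (a b : Euc N) (B : Multivector N) :
    vecContract N a (vec N b * B) = inner ℝ a b • B - vec N b * vecContract N a B :=
  CliffordAlgebra.contractLeft_ι_mul (Q := (0 : QuadraticForm ℝ (Euc N))) _ b B

theorem vecContract_algebraMap (a : Euc N) (r : ℝ) :
    vecContract N a (algebraMap ℝ (Multivector N) r) = 0 :=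
  CliffordAlgebra.contractLeft_algebraMap (Q := (0 : QuadraticForm ℝ (Euc N))) _ r

theorem vecContract_one (a : Euc N) : vecContract N a (1 : Multivector N) = 0 :=
  CliffordAlgebra.contractLeft_one (Q := (0 : QuadraticForm ℝ (Euc N))) _

theorem vecContract_vec (a b : Euc N) :
    vecContract N a (vec N b) = algebraMap ℝ (Multivector N) (inner ℝ a b) :=
  CliffordAlgebra.contractLeft_ι (Q := (0 : QuadraticForm ℝ (Euc N))) _ b

theorem vecContract_comm (a b : Euc N) (B : Multivector N) :
    vecContract N a (vecContract N b B) = -vecContract N b (vecContract N a B) :=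
  CliffordAlgebra.contractLeft_comm (Q := (0 : QuadraticForm ℝ (Euc N))) _ _ B

theorem vec_mul_vec_comm (a b : Euc N) : vec N a * vec N b = -(vec N b * vec N a) :=
  eq_neg_of_add_eq_zero_left (ExteriorAlgebra.ι_add_mul_swap a b)

theorem vec_mul_vec_mul_comm (a b : Euc N) (B : Multivector N) :
    vec N a * (vec N b * B) = -(vec N b * (vec N a * B)) := by
  rw [← mul_assoc, vec_mul_vec_comm, neg_mul, mul_assoc]

theorem leftContract_vec (a : Euc N) : leftContract N (vec N a) = vecContract N a := by
  simp [leftContract]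

theorem leftContract_mul_apply (A B C : Multivector N) :
    leftContract N (A * B) C = leftContract N A (leftContract N B C) := by
  simp

/-- A vector orthogonal to the factors of a blade contracts it to zero. -/
theorem vecContract_ιMulti_eq_zero {m : ℕ} {a : Euc N} {v : Fin m → Euc N}
    (h : ∀ i, inner ℝ a (v i) = 0) : vecContract N a (ExteriorAlgebra.ιMulti ℝ m v) = 0 := by
  induction m with
  | zero => simp [ExteriorAlgebra.ιMulti_zero_apply, vecContract_one]
  | succ m ih =>
    rw [ExteriorAlgebra.ιMulti_succ_apply]
    have := vecContract_vec_mul a (v 0) (ExteriorAlgebra.ιMulti ℝ m (Matrix.vecTail v))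
    rw [this, h 0, ih (v := Matrix.vecTail v) fun i => h i.succ]
    simp

theorem vec_mul_ιMulti {m : ℕ} (a : Euc N) (v : Fin m → Euc N) :
    vec N a * ExteriorAlgebra.ιMulti ℝ m v =
      ExteriorAlgebra.ιMulti ℝ (m + 1) (Matrix.vecCons a v) := by
  rw [ExteriorAlgebra.ιMulti_succ_apply]
  simp

theorem vec_mul_ιMulti_eq_zero {m : ℕ} (v : Fin m → Euc N) (i : Fin m) :
    vec N (v i) * ExteriorAlgebra.ιMulti ℝ m v = 0 := by
  rw [vec_mul_ιMulti]
  exact AlternatingMap.map_eq_zero_of_eq _ _ (i := 0) (j := i.succ) (by simp)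
    (Fin.succ_ne_zero i).symm

/-- Transposing `a` with the factor `v i` in the blade `a ∧ v_1 ∧ … ∧ v_m` costs a sign. -/
theorem vec_mul_ιMulti_eq_neg {m : ℕ} (a : Euc N) (v : Fin m → Euc N) (i : Fin m) :
    vec N a * ExteriorAlgebra.ιMulti ℝ m v =
      -(vec N (v i) * ExteriorAlgebra.ιMulti ℝ m (Function.update v i a)) := by
  rw [vec_mul_ιMulti, vec_mul_ιMulti,
    ← AlternatingMap.map_swap _ _ (Fin.succ_ne_zero i).symm]
  congr 1
  funext j
  refine Fin.cases ?_ (fun j => ?_) j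
  · simp
  · by_cases hj : j = i
    · subst hj; simp
    · rw [Function.comp_apply, Equiv.swap_apply_of_ne_of_ne (Fin.succ_ne_zero j)
        (fun h => hj (Fin.succ_injective _ h))]
      simp [Function.update_of_ne hj]

/-- Replacing one of the factors of an orthonormal blade by a vector orthogonal to it. -/
theorem ιMulti_update_eq {m : ℕ} {v : Fin m → Euc N} (hv : Orthonormal ℝ v) {a : Euc N}
    {i : Fin m} (ha : inner ℝ (v i) a = 0) :
    ExteriorAlgebra.ιMulti ℝ m (Function.update v i a) =
      vec N a * vecContract N (v i) (ExteriorAlgebra.ιMulti ℝ m v) := by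
  have h0 : vecContract N (v i) (ExteriorAlgebra.ιMulti ℝ m (Function.update v i a)) = 0 := by
    refine vecContract_ιMulti_eq_zero fun j => ?_
    by_cases hj : j = i
    · subst hj; simpa using ha
    · rw [Function.update_of_ne hj]
      exact hv.2 (Ne.symm hj)
  have h1 := vecContract_vec_mul (v i) a (ExteriorAlgebra.ιMulti ℝ m v)
  have h2 := vecContract_vec_mul (v i) (v i)
    (ExteriorAlgebra.ιMulti ℝ m (Function.update v i a))
  -- With `B` the blade and `B'` the updated one, `a ∧ B = -(v_i ∧ B')`; contracting both sides by
  -- `v_i`, where `v_i ⌟ B' = 0` and `v_i ⊥ a`, leaves `a ∧ (v_i ⌟ B) = ‖v_i‖² B'`.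
  rw [vec_mul_ιMulti_eq_neg a v i, map_neg, h2, h0, ha] at h1
  simp only [mul_zero, sub_zero, zero_smul, zero_sub, neg_inj] at h1
  rw [← h1, real_inner_self_eq_norm_sq, hv.1 i]
  simp

/-- Reversion makes the contractions act in the order that peels off `v 0` first, each contributing
a factor `‖v_i‖² = 1`. This shows that orthonormal blades are nonzero and that `⋆` sends the
pseudoscalar to `1`. -/
theorem leftContract_reversion_ιMulti_self {m : ℕ} {v : Fin m → Euc N} (hv : Orthonormal ℝ v) :
    leftContract N (reversion N (ExteriorAlgebra.ιMulti ℝ m v))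
      (ExteriorAlgebra.ιMulti ℝ m v) = 1 := by
  induction m with
  | zero => simp [ExteriorAlgebra.ιMulti_zero_apply, reversion_one]
  | succ m ih =>
    have h1 : vecContract N (v 0) (ExteriorAlgebra.ιMulti ℝ m (Matrix.vecTail v)) = 0 :=
      vecContract_ιMulti_eq_zero fun j => hv.2 (Fin.succ_ne_zero j).symm
    have h2 : Orthonormal ℝ (Matrix.vecTail v) := hv.comp _ (Fin.succ_injective m)
    rw [ExteriorAlgebra.ιMulti_succ_apply]
    change leftContract N (reversion N (vec N (v 0) * _)) (vec N (v 0) * _) = 1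
    rw [reversion_mul, leftContract_mul_apply, reversion_vec, leftContract_vec,
      vecContract_vec_mul, h1, real_inner_self_eq_norm_sq, hv.1 0]
    simpa using ih h2

theorem ιMulti_ne_zero {m : ℕ} {v : Fin m → Euc N} (hv : Orthonormal ℝ v) :
    ExteriorAlgebra.ιMulti ℝ m v ≠ 0 := by
  intro h
  have := leftContract_reversion_ιMulti_self hv
  rw [h] at this
  simp at this

theorem continuous_ιMulti (m : ℕ) :
    Continuous fun v : Fin m → Euc N => ExteriorAlgebra.ιMulti ℝ m v := by
  induction m with
  | zero => simpa [ExteriorAlgebra.ιMulti_zero_apply] using continuous_const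
  | succ m ih =>
    have h : (fun v : Fin (m + 1) → Euc N => ExteriorAlgebra.ιMulti ℝ (m + 1) v) =
        fun v => (LinearMap.mul ℝ (Multivector N)).toContinuousBilinearMap
          ((vec N).toContinuousLinearMap (v 0))
          (ExteriorAlgebra.ιMulti ℝ m fun i => v i.succ) := by
      funext v
      exact ExteriorAlgebra.ιMulti_succ_apply v
    rw [h]
    have h1 : Continuous fun v : Fin (m + 1) → Euc N => fun i : Fin m => v i.succ := by
      fun_prop
    have h2 := ih.comp h1
    simp only [Function.comp_def] at h2
    fun_prop

end MultivectorAlgebra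

/-! ### The Hodge dual exchanges contraction and exterior multiplication. -/

section Hodge

variable {N : ℕ}

theorem mul_vec_eq (A : Multivector N) (b : Euc N) :
    A * vec N b = vec N b * gradeInvol N A := by
  induction A using multivector_left_induction with
  | algebraMap r => rw [AlgHom.commutes]; exact Algebra.commutes r _
  | add A B hA hB => rw [add_mul, hA, hB, map_add, mul_add]
  | vec_mul a A hA =>
    rw [mul_assoc, hA, map_mul, gradeInvol_vec, vec_mul_vec_mul_comm, neg_mul, mul_neg]

theorem gradeInvol_vecContract (a : Euc N) (A : Multivector N) :
    gradeInvol N (vecContract N a A) = -vecContract N a (gradeInvol N A) := by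
  induction A using multivector_left_induction with
  | algebraMap r => rw [AlgHom.commutes, vecContract_algebraMap]; simp
  | add A B hA hB => rw [map_add, map_add, map_add, map_add, hA, hB]; abel
  | vec_mul b A hA =>
    rw [vecContract_vec_mul, map_mul, gradeInvol_vec, neg_mul, map_neg, vecContract_vec_mul,
      map_sub, map_smul, map_mul, hA, gradeInvol_vec]
    simp

/-- The Hodge dual as a linear map. -/
def hodge (N : ℕ) : Multivector N →ₗ[ℝ] Multivector N where
  toFun := hodgeDual
  map_add' A B := by simp [hodgeDual]
  map_smul' c A := by simp [hodgeDual]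

theorem hodge_apply (A : Multivector N) :
    hodge N A = leftContract N (reversion N A) (pseudoscalar N) := rfl

theorem hodge_mul_vec (A : Multivector N) (a : Euc N) :
    hodge N (A * vec N a) = vecContract N a (hodge N A) := by
  rw [hodge_apply, reversion_mul, leftContract_mul_apply, reversion_vec, leftContract_vec]
  rfl

/-- `a ⌟ ⋆A = ⋆(a ∧ Â)`, where `Â` is the grade involution of `A`. -/
theorem vecContract_hodge (a : Euc N) (A : Multivector N) :
    vecContract N a (hodge N A) = hodge N (vec N a * gradeInvol N A) := by
  rw [← hodge_mul_vec, mul_vec_eq]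

theorem vec_mul_pseudoscalar (a : Euc N) : vec N a * pseudoscalar N = 0 := by
  have ha := (EuclideanSpace.basisFun (Fin N) ℝ).sum_repr a
  rw [← ha, map_sum, Finset.sum_mul]
  refine Finset.sum_eq_zero fun i _ => ?_
  rw [map_smul, smul_mul_assoc, EuclideanSpace.basisFun_apply]
  have := vec_mul_ιMulti_eq_zero (fun i : Fin N => EuclideanSpace.single i (1 : ℝ)) i
  rw [pseudoscalar, this, smul_zero]

/-- `a ∧ ⋆A = -⋆(a ⌟ Â)`, where `Â` is the grade involution of `A`. -/
theorem vec_mul_hodge (a : Euc N) (A : Multivector N) :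
    vec N a * hodge N A = -hodge N (vecContract N a (gradeInvol N A)) := by
  induction A using multivector_right_induction with
  | algebraMap r =>
    rw [AlgHom.commutes, vecContract_algebraMap, map_zero, neg_zero, Algebra.algebraMap_eq_smul_one,
      map_smul, mul_smul_comm, hodge_apply, reversion_one, map_one]
    simp [vec_mul_pseudoscalar]
  | add A B hA hB => rw [map_add, map_add, map_add, map_add, mul_add, hA, hB]; abel
  | mul_vec b A hA =>
    -- Since `⋆(A ∧ b) = b ⌟ ⋆A`, the inductive step amounts to expanding `b ⌟ (a ∧ ⋆A)`.
    have h1 := vecContract_vec_mul b a (hodge N A)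
    rw [hA, map_neg, vecContract_hodge, gradeInvol_vecContract, gradeInvol_gradeInvol] at h1
    rw [hodge_mul_vec, mul_vec_eq, map_mul, gradeInvol_gradeInvol, gradeInvol_vec, neg_mul,
      map_neg, vecContract_vec_mul, map_neg, neg_neg, map_sub, map_smul, real_inner_comm b a]
    rw [mul_neg, map_neg, neg_neg] at h1
    rw [h1]
    abel

/-- In finite dimension surjectivity suffices: the range contains the scalars, as duals of multiples
of the pseudoscalar, and `vec_mul_hodge` makes it stable under left multiplication by vectors. -/
theorem hodge_injective (N : ℕ) : Function.Injective (hodge N) := by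
  rw [LinearMap.injective_iff_surjective]
  intro A
  change A ∈ Set.range (hodge N)
  induction A using multivector_left_induction with
  | algebraMap r =>
    refine ⟨r • pseudoscalar N, ?_⟩
    rw [map_smul, hodge_apply, Algebra.algebraMap_eq_smul_one]
    congr 1
    have := (EuclideanSpace.basisFun (Fin N) ℝ).orthonormal
    have h2 : (⇑(EuclideanSpace.basisFun (Fin N) ℝ)) =
        fun i => EuclideanSpace.single i (1 : ℝ) := by
      funext i; simp
    rw [h2] at this
    exact leftContract_reversion_ιMulti_self this
  | add A B hA hB =>
    obtain ⟨A', rfl⟩ := hA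
    obtain ⟨B', rfl⟩ := hB
    exact ⟨A' + B', map_add _ _ _⟩
  | vec_mul b A hA =>
    obtain ⟨A', rfl⟩ := hA
    exact ⟨-vecContract N b (gradeInvol N A'), by rw [vec_mul_hodge, map_neg]⟩

end Hodge

/-! ### Basis-free traces of bilinear maps. -/

section LinearAlgebra

variable {N : ℕ}

/-- The trace of a bilinear map over a subspace, computed in an orthonormal basis of the ambient
space. -/
theorem sum_bilin_eq_sum_starProjection {ι V : Type*} [Fintype ι] [AddCommGroup V] [Module ℝ V]
    {K : Submodule ℝ (Euc N)} (b : OrthonormalBasis ι ℝ K) (B : Euc N →ₗ[ℝ] Euc N →ₗ[ℝ] V) :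
    ∑ j, B (b j) (b j) = ∑ i : Fin N, B (K.starProjection (EuclideanSpace.basisFun (Fin N) ℝ i))
      (K.starProjection (EuclideanSpace.basisFun (Fin N) ℝ i)) := by
  classical
  set e := EuclideanSpace.basisFun (Fin N) ℝ
  have h1 : ∀ v : Euc N, K.starProjection v = ∑ j, inner ℝ (b j : Euc N) v • (b j : Euc N) := by
    intro v
    rw [Submodule.starProjection_apply, ← b.sum_repr (K.orthogonalProjectionOnto v)]
    simp [OrthonormalBasis.repr_apply_apply]
  have h2 : ∀ j k, ∑ i, inner ℝ (b j : Euc N) (e i) * inner ℝ (b k : Euc N) (e i) =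
      if j = k then 1 else 0 := by
    intro j k
    have := e.sum_inner_mul_inner (b j : Euc N) (b k)
    simp only [real_inner_comm (e _) (b k : Euc N)]
    simp only [real_inner_comm (b k : Euc N) (e _)] at this ⊢
    rw [this, ← orthonormal_iff_ite.1 b.orthonormal j k]
    rfl
  symm
  calc ∑ i, B (K.starProjection (e i)) (K.starProjection (e i))
      = ∑ i, ∑ j, ∑ k, (inner ℝ (b j : Euc N) (e i) * inner ℝ (b k : Euc N) (e i)) •
          B (b j) (b k) := by
        refine Finset.sum_congr rfl fun i _ => ?_
        simp only [h1, map_sum, LinearMap.sum_apply, map_smul, LinearMap.smul_apply,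
          Finset.smul_sum, smul_smul]
        rw [Finset.sum_comm]
        refine Finset.sum_congr rfl fun j _ => Finset.sum_congr rfl fun k _ => ?_
        rw [mul_comm]
    _ = ∑ j, ∑ k, (∑ i, inner ℝ (b j : Euc N) (e i) * inner ℝ (b k : Euc N) (e i)) •
          B (b j) (b k) := by
        rw [Finset.sum_comm]
        refine Finset.sum_congr rfl fun j _ => ?_
        rw [Finset.sum_comm]
        refine Finset.sum_congr rfl fun k _ => ?_
        rw [Finset.sum_smul]
    _ = ∑ j, B (b j) (b j) := by
        refine Finset.sum_congr rfl fun j _ => ?_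
        simp [h2]

/-- The trace of a bilinear map does not depend on the orthonormal basis. -/
theorem sum_bilin_eq_sum_bilin {ι κ V : Type*} [Fintype ι] [Fintype κ] [AddCommGroup V]
    [Module ℝ V] {K : Submodule ℝ (Euc N)} (b : OrthonormalBasis ι ℝ K)
    (c : OrthonormalBasis κ ℝ K) (B : Euc N →ₗ[ℝ] Euc N →ₗ[ℝ] V) :
    ∑ j, B (b j) (b j) = ∑ j, B (c j) (c j) := by
  rw [sum_bilin_eq_sum_starProjection, sum_bilin_eq_sum_starProjection]

theorem sum_sum_smul_eq_zero {ι V : Type*} [Fintype ι] [AddCommGroup V] [Module ℝ V]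
    {f : ι → ι → V} (hf : ∀ j k, f k j = -f j k) : ∑ j, ∑ k, f j k = 0 := by
  have h : ∑ j, ∑ k, f j k = -∑ j, ∑ k, f j k := by
    conv_lhs => rw [Finset.sum_comm]
    simp only [← Finset.sum_neg_distrib]
    exact Finset.sum_congr rfl fun j _ => Finset.sum_congr rfl fun k _ => hf j k
  have h2 : (2 : ℝ) • ∑ j, ∑ k, f j k = 0 := by
    rw [two_smul]
    exact eq_neg_iff_add_eq_zero.1 h
  exact (smul_eq_zero.1 h2).resolve_left two_ne_zero

end LinearAlgebra

/-! ### Derivatives in tangent directions are well defined. -/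

section TangentialCalculus

variable {N : ℕ} {V : Type*} [NormedAddCommGroup V] [NormedSpace ℝ V] {M : Set (Euc N)}

/-- A derivative within `M` need not be unique as a linear map on `ℝ^N`, so `fderivWithin` is an
arbitrary choice. Its values on velocities of curves in `M` are forced by the chain rule, and hence,
by linearity, so are those on their span. -/
theorem dirDeriv_eq {F : Euc N → V} {F' : Euc N →L[ℝ] V} {x a : Euc N}
    (hF : HasFDerivWithinAt F F' M x) (ha : a ∈ tangentSpace M x) :
    dirDeriv M F x a = F' a := by
  unfold dirDeriv
  induction ha using Submodule.span_induction with
  | mem a ha =>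
    obtain ⟨γ, hγ⟩ := ha
    have h1 := hasDerivAt_comp_curve hF.differentiableWithinAt hγ
    obtain ⟨h0, hM, hd⟩ := hγ
    subst h0
    have h2 := hF.comp (0 : ℝ) (s := γ ⁻¹' M) hd.hasFDerivAt.hasFDerivWithinAt
      (Set.mapsTo_preimage γ M)
    have h3 := (h2.hasFDerivAt hM).hasDerivAt
    simp only [Function.comp_def] at h3
    simpa [dirDeriv] using h1.unique h3
  | zero => simp
  | add a b _ _ ha hb => rw [map_add, map_add, ha, hb]
  | smul c a _ ha => rw [map_smul, map_smul, ha]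

theorem hasFDerivWithinAt_apply_unique {F : Euc N → V} {F₁ F₂ : Euc N →L[ℝ] V} {x a : Euc N}
    (h₁ : HasFDerivWithinAt F F₁ M x) (h₂ : HasFDerivWithinAt F F₂ M x)
    (ha : a ∈ tangentSpace M x) : F₁ a = F₂ a := by
  rw [← dirDeriv_eq h₁ ha, dirDeriv_eq h₂ ha]

theorem dirDeriv_congr {F G : Euc N → V} (h : ∀ y ∈ M, F y = G y) {x : Euc N} (hx : x ∈ M)
    (a : Euc N) : dirDeriv M F x a = dirDeriv M G x a := by
  unfold dirDeriv
  rw [fderivWithin_congr h (h x hx)]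

theorem dirDeriv_clm_comp {W : Type*} [NormedAddCommGroup W] [NormedSpace ℝ W] (L : V →L[ℝ] W)
    {F : Euc N → V} {x a : Euc N} (hF : DifferentiableWithinAt ℝ F M x)
    (ha : a ∈ tangentSpace M x) : dirDeriv M (fun y => L (F y)) x a = L (dirDeriv M F x a) :=
  dirDeriv_eq (L.hasFDerivAt.comp_hasFDerivWithinAt x hF.hasFDerivWithinAt) ha

end TangentialCalculus

/-! ### Local retractions and smoothness of the tangent projection. -/

section Retraction

variable {N : ℕ} {M : Set (Euc N)}

/-- A smooth retraction `r` of the open set `U` to `M`. -/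
structure IsLocalRetraction (M U : Set (Euc N)) (r : Euc N → Euc N) : Prop where
  isOpen : IsOpen U
  contDiffOn : ContDiffOn ℝ ∞ r U
  mem : ∀ y ∈ U, r y ∈ M
  eq_self : ∀ y ∈ U, y ∈ M → r y = y

/-- In a straightening chart, project orthogonally onto the linear model `W`; the domain is cut down
so that the projected point stays in the chart's target. -/
theorem IsSmoothSubmanifold.exists_localRetraction {m : ℕ} (hM : IsSmoothSubmanifold m M)
    {x : Euc N} (hx : x ∈ M) : ∃ U r, x ∈ U ∧ IsLocalRetraction M U r := by
  obtain ⟨W, Φ, -, hxΦ, hΦ, hΦs, hMW⟩ := hM x hx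
  have hc : ContinuousOn (fun y => W.starProjection (Φ y)) Φ.source :=
    W.starProjection.continuous.comp_continuousOn Φ.continuousOn
  refine ⟨Φ.source ∩ (fun y => W.starProjection (Φ y)) ⁻¹' Φ.target,
    fun y => Φ.symm (W.starProjection (Φ y)), ⟨hxΦ, ?_⟩, ?_, ?_, ?_, ?_⟩
  · rw [Set.mem_preimage, Submodule.starProjection_eq_self_iff.2 ((hMW x hxΦ).1 hx)]
    exact Φ.map_source hxΦ
  · exact hc.isOpen_inter_preimage Φ.open_source Φ.open_target
  · refine hΦs.comp ?_ fun y hy => hy.2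
    exact W.starProjection.contDiff.comp_contDiffOn (hΦ.mono Set.inter_subset_left)
  · intro y hy
    rw [hMW _ (Φ.map_target hy.2), Φ.right_inv hy.2]
    exact Submodule.starProjection_apply_mem _ _
  · intro y hy hyM
    rw [Submodule.starProjection_eq_self_iff.2 ((hMW y hy.1).1 hyM), Φ.left_inv hy.1]

namespace IsLocalRetraction

variable {U : Set (Euc N)} {r : Euc N → Euc N}

theorem contDiffAt (h : IsLocalRetraction M U r) {y : Euc N} (hy : y ∈ U) :
    ContDiffAt ℝ ∞ r y :=
  h.contDiffOn.contDiffAt (h.isOpen.mem_nhds hy)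

theorem hasFDerivAt (h : IsLocalRetraction M U r) {y : Euc N} (hy : y ∈ U) :
    HasFDerivAt r (fderiv ℝ r y) y :=
  ((h.contDiffAt hy).differentiableAt (by simp)).hasFDerivAt

/-- The curve `t ↦ r (y + t • v)` lies in `M` near `0` and has velocity `Dr_y v`. -/
theorem fderiv_mem (h : IsLocalRetraction M U r) {y : Euc N} (hy : y ∈ U) (hyM : y ∈ M)
    (v : Euc N) : fderiv ℝ r y v ∈ tangentSpace M y := by
  have hl : HasDerivAt (fun t : ℝ => y + t • v) v 0 := by
    simpa using ((hasDerivAt_id (0 : ℝ)).smul_const v).const_add y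
  have hl0 : y + (0 : ℝ) • v = y := by simp
  refine Submodule.subset_span ⟨fun t => r (y + t • v), ?_, ?_, ?_⟩
  · simp [h.eq_self y hy hyM]
  · have : ∀ᶠ t in 𝓝 (0 : ℝ), y + t • v ∈ U :=
      hl.continuousAt.eventually_mem (by rw [hl0]; exact h.isOpen.mem_nhds hy)
    exact this.mono fun t ht => h.mem _ ht
  · have h1 : HasFDerivAt r (fderiv ℝ r y) (y + (0 : ℝ) • v) := by
      rw [hl0]; exact h.hasFDerivAt hy
    exact h1.comp_hasDerivAt (0 : ℝ) hl

theorem eventually_mem (h : IsLocalRetraction M U r) {y : Euc N} (hy : y ∈ U) :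
    ∀ᶠ z in 𝓝[M] y, z ∈ U :=
  nhdsWithin_le_nhds (h.isOpen.mem_nhds hy)

/-- On `M` near `y`, `r` coincides with the identity, so the two derivatives agree in tangent
directions. Thus `Dr_y` is a projection onto `T_y M`, in general an oblique one. -/
theorem fderiv_eq_self (h : IsLocalRetraction M U r) {y : Euc N} (hy : y ∈ U) (hyM : y ∈ M)
    {a : Euc N} (ha : a ∈ tangentSpace M y) : fderiv ℝ r y a = a := by
  have h1 : HasFDerivWithinAt (fun z => z) (fderiv ℝ r y) M y := by
    refine (h.hasFDerivAt hy).hasFDerivWithinAt.congr_of_eventuallyEq ?_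
      (h.eq_self y hy hyM).symm
    filter_upwards [h.eventually_mem hy, self_mem_nhdsWithin] with z hz hzM
    exact (h.eq_self z hz hzM).symm
  exact hasFDerivWithinAt_apply_unique h1 (hasFDerivWithinAt_id y M) ha

end IsLocalRetraction

/-- `1 + Q - Q*` is invertible, since `Q - Q*` is skew-adjoint. -/
theorem isUnit_one_add_sub_adjoint (Q : Euc N →L[ℝ] Euc N) :
    IsUnit (1 + (Q - ContinuousLinearMap.adjoint Q)) := by
  set S := 1 + (Q - ContinuousLinearMap.adjoint Q) with hS
  have hinj : Function.Injective S := by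
    rw [injective_iff_map_eq_zero]
    intro v hv
    have h1 : inner ℝ (S v) v = inner ℝ v v := by
      simp only [hS, add_apply, sub_apply,
        one_apply_eq_self, inner_add_left, inner_sub_left,
        ContinuousLinearMap.adjoint_inner_left]
      rw [real_inner_comm v (Q v)]
      ring
    rw [hv, inner_zero_left] at h1
    exact inner_self_eq_zero.1 h1.symm
  have hb : IsUnit (S : Euc N →ₗ[ℝ] Euc N) :=
    (LinearMap.isUnit_iff_ker_eq_bot _).2 (LinearMap.ker_eq_bot.2 hinj)
  rw [ContinuousLinearMap.isUnit_iff_bijective]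
  exact ⟨hinj, LinearMap.injective_iff_surjective.1 hinj⟩

/-- The Kerzman–Stein formula for the orthogonal projection onto the range of an idempotent `Q`. -/
theorem starProjection_eq_mul_inverse {K : Submodule ℝ (Euc N)} {Q : Euc N →L[ℝ] Euc N}
    (hmem : ∀ v, Q v ∈ K) (hself : ∀ v ∈ K, Q v = v) :
    K.starProjection = Q * Ring.inverse (1 + (Q - ContinuousLinearMap.adjoint Q)) := by
  have hu := isUnit_one_add_sub_adjoint Q
  set P := K.starProjection with hP
  have h1 : P * Q = Q := by
    ext1 v
    exact Submodule.starProjection_eq_self_iff.2 (hmem v)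
  have h2 : Q * P = P := by
    ext1 v
    exact hself _ (Submodule.starProjection_apply_mem _ _)
  have h3 : P * ContinuousLinearMap.adjoint Q = P := by
    have h4 : ContinuousLinearMap.adjoint P = P :=
      (ContinuousLinearMap.isSelfAdjoint_iff' (A := P)).1 (isSelfAdjoint_starProjection K)
    have h5 := congrArg ContinuousLinearMap.adjoint h2
    change ContinuousLinearMap.adjoint (Q.comp P) = _ at h5
    rw [ContinuousLinearMap.adjoint_comp, h4] at h5
    exact h5
  -- `P Q = Q`, and the adjoint of `Q P = P` is `P Q* = P`, so the left side is `P + Q - P`.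
  have h4 : P * (1 + (Q - ContinuousLinearMap.adjoint Q)) = Q := by
    rw [mul_add, mul_sub, h1, h3]; simp
  calc P = P * ((1 + (Q - ContinuousLinearMap.adjoint Q)) *
        Ring.inverse (1 + (Q - ContinuousLinearMap.adjoint Q))) := by
        rw [Ring.mul_inverse_cancel _ hu, mul_one]
    _ = _ := by rw [← mul_assoc, h4]

/-- An extension to a neighbourhood of the field of the orthogonal projections onto the tangent
spaces, obtained from a local retraction. -/
def projExt (r : Euc N → Euc N) (y : Euc N) : Euc N →L[ℝ] Euc N :=
  fderiv ℝ r y *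
    Ring.inverse (1 + (fderiv ℝ r y - ContinuousLinearMap.adjoint (fderiv ℝ r y)))

namespace IsLocalRetraction

variable {U : Set (Euc N)} {r : Euc N → Euc N}

theorem starProjection_eq (h : IsLocalRetraction M U r) {y : Euc N} (hy : y ∈ U) (hyM : y ∈ M) :
    (tangentSpace M y).starProjection = projExt r y :=
  starProjection_eq_mul_inverse (h.fderiv_mem hy hyM) fun _ hv => h.fderiv_eq_self hy hyM hv

theorem contDiffAt_fderiv (h : IsLocalRetraction M U r) {y : Euc N} (hy : y ∈ U) :
    ContDiffAt ℝ ∞ (fderiv ℝ r) y :=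
  (h.contDiffAt hy).fderiv_right (by simp)

theorem contDiffAt_projExt (h : IsLocalRetraction M U r) {y : Euc N} (hy : y ∈ U) :
    ContDiffAt ℝ ∞ (projExt r) y := by
  have h1 := h.contDiffAt_fderiv hy
  have h2 : ContDiffAt ℝ ∞ (fun y => ContinuousLinearMap.adjoint (fderiv ℝ r y)) y :=
    (starL' ℝ (A := Euc N →L[ℝ] Euc N)).contDiff.contDiffAt.comp y h1
  have h3 : ContDiffAt ℝ ∞ (fun y => 1 + (fderiv ℝ r y -
      ContinuousLinearMap.adjoint (fderiv ℝ r y))) y :=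
    contDiffAt_const.add (h1.sub h2)
  obtain ⟨u, hu⟩ := isUnit_one_add_sub_adjoint (fderiv ℝ r y)
  have h4 : ContDiffAt ℝ ∞ Ring.inverse
      (1 + (fderiv ℝ r y - ContinuousLinearMap.adjoint (fderiv ℝ r y))) := by
    rw [← hu]; exact contDiffAt_ringInverse ℝ u
  have h5 := ContDiffAt.comp (g := Ring.inverse) y h4 h3
  exact h1.mul h5

end IsLocalRetraction

end Retraction

/-! ### The second fundamental form and the mean curvature via the derivative of the projection. -/

section Curvature

variable {N : ℕ} {M : Set (Euc N)}

/-- The orthogonal projection onto the tangent space. -/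
def tanProj (M : Set (Euc N)) (y : Euc N) : Euc N →L[ℝ] Euc N :=
  (tangentSpace M y).starProjection

/-- The derivative on `M` of the field of the projections onto the tangent spaces. -/
def projDeriv (M : Set (Euc N)) (x : Euc N) : Euc N →L[ℝ] Euc N →L[ℝ] Euc N :=
  fderivWithin ℝ (tanProj M) M x

theorem tanProj_eq_self {x v : Euc N} (hv : v ∈ tangentSpace M x) : tanProj M x v = v :=
  Submodule.starProjection_eq_self_iff.2 hv

theorem tanProj_mem (x v : Euc N) : tanProj M x v ∈ tangentSpace M x :=
  Submodule.starProjection_apply_mem _ _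

theorem tanProj_inner (x u v : Euc N) :
    inner ℝ (tanProj M x u) v = inner ℝ u (tanProj M x v) :=
  Submodule.starProjection_isSymmetric _ u v

namespace IsLocalRetraction

variable {U : Set (Euc N)} {r : Euc N → Euc N}

theorem hasFDerivWithinAt_tanProj (h : IsLocalRetraction M U r) {y : Euc N} (hy : y ∈ U)
    (hyM : y ∈ M) : HasFDerivWithinAt (tanProj M) (fderiv ℝ (projExt r) y) M y := by
  have h1 : HasFDerivAt (projExt r) (fderiv ℝ (projExt r) y) y :=
    ((h.contDiffAt_projExt hy).differentiableAt (by simp)).hasFDerivAt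
  refine h1.hasFDerivWithinAt.congr_of_eventuallyEq ?_ (h.starProjection_eq hy hyM)
  filter_upwards [h.eventually_mem hy, self_mem_nhdsWithin] with z hz hzM
  exact h.starProjection_eq hz hzM

theorem projDeriv_apply (h : IsLocalRetraction M U r) {y a : Euc N} (hy : y ∈ U)
    (hyM : y ∈ M) (ha : a ∈ tangentSpace M y) :
    projDeriv M y a = fderiv ℝ (projExt r) y a :=
  dirDeriv_eq (h.hasFDerivWithinAt_tanProj hy hyM) ha

end IsLocalRetraction

variable {m : ℕ} {x : Euc N}

theorem IsSmoothSubmanifold.hasFDerivWithinAt_tanProj (hM : IsSmoothSubmanifold m M) (hx : x ∈ M) :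
    HasFDerivWithinAt (tanProj M) (projDeriv M x) M x := by
  obtain ⟨U, r, hxU, h⟩ := hM.exists_localRetraction hx
  exact (h.hasFDerivWithinAt_tanProj hxU hx).differentiableWithinAt.hasFDerivWithinAt

theorem IsSmoothSubmanifold.hasFDerivWithinAt_tanProj_apply (hM : IsSmoothSubmanifold m M)
    (hx : x ∈ M) (v : Euc N) :
    HasFDerivWithinAt (fun y => tanProj M y v) ((projDeriv M x).flip v) M x := by
  have := (hM.hasFDerivWithinAt_tanProj hx).clm_apply (hasFDerivWithinAt_const v x M)
  refine this.congr_fderiv ?_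
  ext a
  simp

theorem IsSmoothSubmanifold.projDeriv_inner (hM : IsSmoothSubmanifold m M) (hx : x ∈ M)
    {a : Euc N} (ha : a ∈ tangentSpace M x) (u v : Euc N) :
    inner ℝ (projDeriv M x a u) v = inner ℝ u (projDeriv M x a v) := by
  have h1 := (hM.hasFDerivWithinAt_tanProj_apply hx u).inner ℝ (hasFDerivWithinAt_const v x M)
  have h2 := (hasFDerivWithinAt_const u x M).inner ℝ (hM.hasFDerivWithinAt_tanProj_apply hx v)
  simp only [tanProj_inner] at h1
  simpa using hasFDerivWithinAt_apply_unique h1 h2 ha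

/-- The derivative of the tangent projection takes tangent vectors to normal ones. -/
theorem IsSmoothSubmanifold.tanProj_projDeriv (hM : IsSmoothSubmanifold m M) (hx : x ∈ M)
    {a b : Euc N} (ha : a ∈ tangentSpace M x) (hb : b ∈ tangentSpace M x) :
    tanProj M x (projDeriv M x a b) = 0 := by
  have h1 := hM.hasFDerivWithinAt_tanProj_apply hx b
  have h2 := (hM.hasFDerivWithinAt_tanProj hx).clm_apply h1
  -- Differentiating `P P b = P b` along `a` gives `P'_a b = P'_a (P b) + P (P'_a b)`, with `P b =
  -- b` at `x`.
  simp only [fun y => tanProj_eq_self (tanProj_mem (M := M) y b)] at h2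
  have h3 := hasFDerivWithinAt_apply_unique h1 h2 ha
  simpa [tanProj_eq_self hb] using h3

theorem IsSmoothSubmanifold.inner_projDeriv (hM : IsSmoothSubmanifold m M) (hx : x ∈ M)
    {a b c : Euc N} (ha : a ∈ tangentSpace M x) (hb : b ∈ tangentSpace M x)
    (hc : c ∈ tangentSpace M x) : inner ℝ c (projDeriv M x a b) = 0 := by
  rw [← tanProj_eq_self hc, tanProj_inner, hM.tanProj_projDeriv hx ha hb, inner_zero_right]

/-- Differentiating `P (Dr b) = Dr b` along `a` exhibits `P'_a b` as the normal part of `D²r(a, b)`,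
which is symmetric. -/
theorem IsSmoothSubmanifold.projDeriv_comm (hM : IsSmoothSubmanifold m M) (hx : x ∈ M)
    {a b : Euc N} (ha : a ∈ tangentSpace M x) (hb : b ∈ tangentSpace M x) :
    projDeriv M x a b = projDeriv M x b a := by
  obtain ⟨U, r, hxU, h⟩ := hM.exists_localRetraction hx
  have hsymm : IsSymmSndFDerivAt ℝ r x := (h.contDiffAt hxU).isSymmSndFDerivAt (by
    rw [minSmoothness_of_isRCLikeNormedField]
    exact WithTop.coe_le_coe.2 (le_top : (2 : ℕ∞) ≤ ⊤))
  have key : ∀ {a b : Euc N}, a ∈ tangentSpace M x → b ∈ tangentSpace M x →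
      projDeriv M x a b = fderiv ℝ (fderiv ℝ r) x a b -
        tanProj M x (fderiv ℝ (fderiv ℝ r) x a b) := by
    intro a b ha hb
    have h1 : HasFDerivAt (fderiv ℝ r) (fderiv ℝ (fderiv ℝ r) x) x :=
      ((h.contDiffAt_fderiv hxU).differentiableAt (by simp)).hasFDerivAt
    have h2 := h1.hasFDerivWithinAt (s := M) |>.clm_apply (hasFDerivWithinAt_const b x M)
    have h3 := (hM.hasFDerivWithinAt_tanProj hx).clm_apply h2
    have h4 := h3.congr_of_eventuallyEq (f₁ := fun y => fderiv ℝ r y b) (by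
      filter_upwards [h.eventually_mem hxU, self_mem_nhdsWithin] with z hz hzM
      exact (tanProj_eq_self (h.fderiv_mem hz hzM b)).symm)
      (tanProj_eq_self (h.fderiv_mem hxU hx b)).symm
    have h5 := hasFDerivWithinAt_apply_unique h2 h4 ha
    simp only [ContinuousLinearMap.comp_zero, zero_add, ContinuousLinearMap.flip_apply,
      add_apply, ContinuousLinearMap.comp_apply, h.fderiv_eq_self hxU hx hb] at h5
    exact eq_sub_of_add_eq' h5.symm
  rw [key ha hb, key hb ha, hsymm a b]

theorem IsSmoothSubmanifold.secondFundamentalForm_eq (hM : IsSmoothSubmanifold m M) (hx : x ∈ M)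
    {a b : Euc N} (ha : a ∈ tangentSpace M x) (hb : b ∈ tangentSpace M x) :
    secondFundamentalForm M x a b = projDeriv M x a b := by
  have h1 := dirDeriv_eq (hM.hasFDerivWithinAt_tanProj_apply hx b) ha
  unfold secondFundamentalForm
  change (tangentSpace M x)ᗮ.starProjection (dirDeriv M (fun y => tanProj M y b) x a) = _
  rw [h1, Submodule.starProjection_orthogonal]
  change projDeriv M x a b - tanProj M x (projDeriv M x a b) = _
  rw [hM.tanProj_projDeriv hx ha hb, sub_zero]

theorem IsSmoothSubmanifold.meanCurvature_eq (hM : IsSmoothSubmanifold m M) (hx : x ∈ M) :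
    meanCurvature M x = ∑ j, projDeriv M x (frame M x j) (frame M x j) :=
  Finset.sum_congr rfl fun j _ =>
    hM.secondFundamentalForm_eq hx (frame M x j).2 (frame M x j).2

theorem IsSmoothSubmanifold.tanProj_meanCurvature (hM : IsSmoothSubmanifold m M) (hx : x ∈ M) :
    tanProj M x (meanCurvature M x) = 0 := by
  rw [hM.meanCurvature_eq hx, map_sum]
  exact Finset.sum_eq_zero fun j _ => hM.tanProj_projDeriv hx (frame M x j).2 (frame M x j).2

theorem IsSmoothSubmanifold.inner_meanCurvature (hM : IsSmoothSubmanifold m M) (hx : x ∈ M)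
    {a : Euc N} (ha : a ∈ tangentSpace M x) : inner ℝ a (meanCurvature M x) = 0 := by
  rw [← tanProj_eq_self ha, tanProj_inner, hM.tanProj_meanCurvature hx, inner_zero_right]

/-- The chosen frames need not vary continuously, so the trace is rewritten over the projections of
the standard basis of `ℝ^N`, which extend smoothly through `projExt`. -/
theorem IsSmoothSubmanifold.differentiableWithinAt_meanCurvature (hM : IsSmoothSubmanifold m M)
    (hx : x ∈ M) : DifferentiableWithinAt ℝ (meanCurvature M) M x := by
  obtain ⟨U, r, hxU, h⟩ := hM.exists_localRetraction hx
  have key : ∀ y ∈ U, y ∈ M → meanCurvature M y = ∑ i : Fin N, fderiv ℝ (projExt r) y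
      (projExt r y (EuclideanSpace.basisFun (Fin N) ℝ i))
      (projExt r y (EuclideanSpace.basisFun (Fin N) ℝ i)) := by
    intro y hy hyM
    rw [hM.meanCurvature_eq hyM]
    have h1 := sum_bilin_eq_sum_starProjection (frame M y)
      ((ContinuousLinearMap.coeLM ℝ).comp (projDeriv M y : Euc N →ₗ[ℝ] Euc N →L[ℝ] Euc N))
    refine h1.trans (Finset.sum_congr rfl fun i _ => ?_)
    rw [← h.starProjection_eq hy hyM, ← h.projDeriv_apply hy hyM (Submodule.starProjection_apply_mem _ _)]
    rfl
  have h1 : DifferentiableAt ℝ (projExt r) x :=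
    (h.contDiffAt_projExt hxU).differentiableAt (by simp)
  have h2 : DifferentiableAt ℝ (fderiv ℝ (projExt r)) x :=
    ((h.contDiffAt_projExt hxU).fderiv_right (m := ∞) (by simp)).differentiableAt (by simp)
  have h3 : DifferentiableAt ℝ (fun y => ∑ i : Fin N, fderiv ℝ (projExt r) y
      (projExt r y (EuclideanSpace.basisFun (Fin N) ℝ i))
      (projExt r y (EuclideanSpace.basisFun (Fin N) ℝ i))) x := by
    fun_prop
  refine h3.differentiableWithinAt.congr_of_eventuallyEq ?_ (key x hxU hx)
  filter_upwards [h.eventually_mem hxU, self_mem_nhdsWithin] with z hz hzM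
  exact key z hz hzM

/-- The tangential part of the derivative of the mean curvature vector is symmetric. -/
theorem IsSmoothSubmanifold.inner_dirDeriv_meanCurvature_comm (hM : IsSmoothSubmanifold m M)
    (hx : x ∈ M) {a b : Euc N} (ha : a ∈ tangentSpace M x) (hb : b ∈ tangentSpace M x) :
    inner ℝ b (dirDeriv M (meanCurvature M) x a) =
      inner ℝ a (dirDeriv M (meanCurvature M) x b) := by
  have key : ∀ {a b : Euc N}, a ∈ tangentSpace M x → b ∈ tangentSpace M x →
      inner ℝ b (dirDeriv M (meanCurvature M) x a) =
        -inner ℝ (projDeriv M x a b) (meanCurvature M x) := by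
    intro a b ha hb
    -- Differentiate `P H = 0` along `a`: `P (D_a H) = -P'_a H`; then pair with `b` and use that `P`
    -- and `P'_a` are self-adjoint.
    have h1 := (hM.hasFDerivWithinAt_tanProj hx).clm_apply
      (hM.differentiableWithinAt_meanCurvature hx).hasFDerivWithinAt
    have h2 := h1.congr_of_eventuallyEq (f₁ := fun _ => (0 : Euc N)) (by
      filter_upwards [self_mem_nhdsWithin] with z hz
      exact (hM.tanProj_meanCurvature hz).symm) (hM.tanProj_meanCurvature hx).symm
    have h3 := hasFDerivWithinAt_apply_unique h2 (hasFDerivWithinAt_const _ _ _) ha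
    simp only [ContinuousLinearMap.flip_apply,
      add_apply, ContinuousLinearMap.comp_apply, zero_apply] at h3
    rw [hM.projDeriv_inner hx ha, ← inner_neg_right, ← eq_neg_of_add_eq_zero_left h3,
      ← tanProj_inner, tanProj_eq_self hb]
    rfl
  rw [key ha hb, key hb ha, hM.projDeriv_comm hx ha hb]

end Curvature

/-! ### Determinants and differentiation of blades. -/

section GaussMapDeriv

variable {N m : ℕ}

/-- A blade of vectors of an `m`-dimensional subspace is a multiple of the blade of a basis. -/
theorem ιMulti_eq_det_smul {K : Submodule ℝ (Euc N)} (e : Module.Basis (Fin m) ℝ K)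
    (w : Fin m → K) : ExteriorAlgebra.ιMulti ℝ m (fun i => (w i : Euc N)) =
      e.det w • ExteriorAlgebra.ιMulti ℝ m fun i => (e i : Euc N) := by
  let f : K [⋀^Fin m]→ₗ[ℝ] Multivector N :=
    (ExteriorAlgebra.ιMulti ℝ m).compLinearMap K.subtype
  let g : K [⋀^Fin m]→ₗ[ℝ] Multivector N :=
    (LinearMap.toSpanSingleton ℝ _ (f e)).compAlternatingMap e.det
  have hfg : f = g := by
    refine e.ext_alternating fun v hv => ?_
    let σ : Equiv.Perm (Fin m) := Equiv.ofBijective v (Finite.injective_iff_bijective.1 hv)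
    have h1 := f.map_perm e σ
    have h2 := g.map_perm e σ
    have h3 : g e = f e := by simp [g, e.det_self]
    rw [h3, ← h1] at h2
    exact h2.symm
  exact DFunLike.congr_fun hfg w

/-- The Gram determinant is the square of the determinant in an orthonormal basis. -/
theorem det_gram_eq_sq {K : Submodule ℝ (Euc N)} (e : OrthonormalBasis (Fin m) ℝ K)
    (w : Fin m → K) :
    (Matrix.of fun i j => inner ℝ (w i : Euc N) (w j)).det = e.toBasis.det w ^ 2 := by
  have h : (Matrix.of fun i j => inner ℝ (w i : Euc N) (w j)) =
      (e.toBasis.toMatrix w).transpose * e.toBasis.toMatrix w := by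
    ext i j
    rw [Matrix.mul_apply]
    have := e.sum_inner_mul_inner (w i) (w j)
    simp only [Matrix.transpose_apply, Module.Basis.toMatrix_apply, Matrix.of_apply,
      e.coe_toBasis_repr_apply, e.repr_apply_apply]
    simp only [real_inner_comm (w i)] at this ⊢
    exact this.symm
  rw [h, Matrix.det_mul, Matrix.det_transpose, Module.Basis.det_apply, sq]

theorem differentiable_det (m : ℕ) :
    Differentiable ℝ fun b : Fin m → Fin m → ℝ => (Matrix.of b).det := by
  simp only [Matrix.det_apply, Matrix.of_apply]
  fun_prop

theorem hasFDerivAt_ιMulti (v : Fin m → Euc N) :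
    ∃ L : (Fin m → Euc N) →L[ℝ] Multivector N,
      HasFDerivAt (fun v : Fin m → Euc N => ExteriorAlgebra.ιMulti ℝ m v) L v ∧
      ∀ w, L w = ∑ k, ExteriorAlgebra.ιMulti ℝ m (Function.update v k (w k)) := by
  let f : ContinuousMultilinearMap ℝ (fun _ : Fin m => Euc N) (Multivector N) :=
    ⟨(ExteriorAlgebra.ιMulti ℝ m : Euc N [⋀^Fin m]→ₗ[ℝ] Multivector N).toMultilinearMap,
      continuous_ιMulti m⟩
  exact ⟨f.linearDeriv v, f.hasFDerivAt v, fun w => f.linearDeriv_apply v w⟩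

end GaussMapDeriv

/-! ### Differentiability and derivative of the Gauss map. -/

section GaussMapDerivative

variable {N m : ℕ} {M : Set (Euc N)} {T : Euc N → Multivector N} {x : Euc N}

theorem orthonormal_coe {ι : Type*} {K : Submodule ℝ (Euc N)} [Fintype ι]
    (b : OrthonormalBasis ι ℝ K) : Orthonormal ℝ fun j => (b j : Euc N) :=
  b.orthonormal.comp_linearIsometry K.subtypeₗᵢ

theorem IsGaussMap.ne_zero (hT : IsGaussMap m M T) (hx : x ∈ M) : T x ≠ 0 := by
  obtain ⟨τ, hτ⟩ := hT.eq_blade x hx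
  rw [hτ]
  exact ιMulti_ne_zero (orthonormal_coe τ)

theorem IsGaussMap.vec_mul_eq_zero (hT : IsGaussMap m M T) (hx : x ∈ M) {a : Euc N}
    (ha : a ∈ tangentSpace M x) : vec N a * T x = 0 := by
  obtain ⟨τ, hτ⟩ := hT.eq_blade x hx
  have h := congrArg (Submodule.subtype _) (τ.sum_repr ⟨a, ha⟩)
  simp only [map_sum, map_smul, Submodule.subtype_apply] at h
  rw [← h, map_sum, Finset.sum_mul]
  refine Finset.sum_eq_zero fun i _ => ?_
  rw [map_smul, smul_mul_assoc, hτ]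
  have := vec_mul_ιMulti_eq_zero (fun j => (τ j : Euc N)) i
  rw [this, smul_zero]

theorem IsGaussMap.vecContract_eq_zero (hT : IsGaussMap m M T) (hx : x ∈ M) {n : Euc N}
    (hn : ∀ a ∈ tangentSpace M x, inner ℝ n a = 0) : vecContract N n (T x) = 0 := by
  obtain ⟨τ, hτ⟩ := hT.eq_blade x hx
  rw [hτ]
  exact vecContract_ιMulti_eq_zero fun i => hn _ (τ i).2

theorem IsGaussMap.vec_mul_vecContract (hT : IsGaussMap m M T) (hx : x ∈ M) {a : Euc N}
    (ha : a ∈ tangentSpace M x) (b : Euc N) :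
    vec N a * vecContract N b (T x) = inner ℝ b a • T x := by
  have h := vecContract_vec_mul b a (T x)
  rw [hT.vec_mul_eq_zero hx ha, map_zero] at h
  exact (sub_eq_zero.1 h.symm).symm

/-- Near a point `x`, the Gauss map is the normalized projection of the blade at `x`. -/
theorem IsGaussMap.eventually_eq (hM : IsSmoothSubmanifold m M) (hT : IsGaussMap m M T)
    (hx : x ∈ M) (τ : OrthonormalBasis (Fin m) ℝ (tangentSpace M x))
    (hτ : T x = ExteriorAlgebra.ιMulti ℝ m fun j => (τ j : Euc N)) :
    T =ᶠ[𝓝[M] x] fun y =>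
      (√(Matrix.of fun i j => inner ℝ (tanProj M y (τ i)) (τ j : Euc N)).det)⁻¹ •
        ExteriorAlgebra.ιMulti ℝ m fun j => tanProj M y (τ j) := by
  set g : Euc N → ℝ := fun y =>
    (Matrix.of fun i j => inner ℝ (tanProj M y (τ i)) (τ j : Euc N)).det with hg
  set G : Euc N → Multivector N := fun y =>
    ExteriorAlgebra.ιMulti ℝ m fun j => tanProj M y (τ j) with hG
  have hPc : ∀ v, ContinuousWithinAt (fun y => tanProj M y v) M x := fun v =>
    (hM.hasFDerivWithinAt_tanProj_apply hx v).continuousWithinAt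
  have hGc : ContinuousWithinAt G M x :=
    (continuous_ιMulti m).continuousAt.comp_continuousWithinAt
      (continuousWithinAt_pi.2 fun j => hPc (τ j))
  have hgc : ContinuousWithinAt g M x :=
    (differentiable_det m).continuous.continuousAt.comp_continuousWithinAt
      (continuousWithinAt_pi.2 fun i => continuousWithinAt_pi.2 fun j =>
        (hPc (τ i)).inner continuousWithinAt_const)
  have hPx : ∀ j, tanProj M x (τ j) = τ j := fun j => tanProj_eq_self (τ j).2
  have hGx : G x = T x := by simp only [hG, hPx, hτ]
  have hgx : g x = 1 := by
    simp only [hg, hPx]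
    have : (Matrix.of fun i j => inner ℝ (τ i : Euc N) (τ j : Euc N)) = 1 := by
      ext i j
      rw [Matrix.of_apply, orthonormal_iff_ite.1 (orthonormal_coe τ) i j, Matrix.one_apply]
    rw [this, Matrix.det_one]
  have hSc : ContinuousWithinAt (fun y => (√(g y))⁻¹ • G y) M x :=
    (hgc.sqrt.inv₀ (by simp [hgx])).smul hGc
  -- Both are unit blades of `T_y M`, hence equal up to sign. Continuity of `T` settles the sign:
  -- the sum is `2 T x ≠ 0` at `x`, so it stays nonzero nearby.
  have hne : ∀ᶠ y in 𝓝[M] x, T y + (√(g y))⁻¹ • G y ≠ 0 := by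
    refine ((hT.continuousOn x hx).add hSc).eventually_ne ?_
    rw [Pi.add_apply, hgx, hGx, Real.sqrt_one, inv_one, one_smul, ← two_smul ℝ]
    exact smul_ne_zero two_ne_zero (hT.ne_zero hx)
  have hpos : ∀ᶠ y in 𝓝[M] x, 0 < g y :=
    hgc.eventually_mem (isOpen_Ioi.mem_nhds (by simp [hgx]))
  filter_upwards [hne, hpos, self_mem_nhdsWithin] with y hy hgy hyM
  obtain ⟨σ, hσ⟩ := hT.eq_blade y hyM
  let w : Fin m → tangentSpace M y := fun j => ⟨tanProj M y (τ j), tanProj_mem y _⟩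
  have h1 : G y = σ.toBasis.det w • T y := by
    rw [hσ]
    have := ιMulti_eq_det_smul σ.toBasis w
    simpa only [OrthonormalBasis.coe_toBasis] using this
  have h2 : g y = σ.toBasis.det w ^ 2 := by
    rw [← det_gram_eq_sq]
    simp only [hg, w]
    congr 2
    funext i j
    rw [tanProj_inner, tanProj_inner, tanProj_eq_self (tanProj_mem y _)]
  have h3 : σ.toBasis.det w ≠ 0 := by
    rintro h
    rw [h2, h] at hgy
    simp at hgy
  change T y = (√(g y))⁻¹ • G y
  rw [h1, h2, Real.sqrt_sq_eq_abs, smul_smul] at hy ⊢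
  rcases abs_choice (σ.toBasis.det w) with h | h
  · rw [h, inv_mul_cancel₀ h3, one_smul]
  · rw [h, inv_neg, neg_mul, inv_mul_cancel₀ h3, neg_smul, one_smul] at hy
    exact absurd (add_neg_cancel _) hy

/-- The derivative of the Gauss map in terms of the derivative of the tangent projection. -/
theorem IsGaussMap.exists_hasFDerivWithinAt (hM : IsSmoothSubmanifold m M)
    (hT : IsGaussMap m M T) (hx : x ∈ M) (τ : OrthonormalBasis (Fin m) ℝ (tangentSpace M x))
    (hτ : T x = ExteriorAlgebra.ιMulti ℝ m fun j => (τ j : Euc N)) :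
    ∃ T' : Euc N →L[ℝ] Multivector N, HasFDerivWithinAt T T' M x ∧
      ∀ a ∈ tangentSpace M x, T' a = ∑ k, vec N (projDeriv M x a (τ k)) *
        vecContract N (τ k) (T x) := by
  have hP : ∀ v, HasFDerivWithinAt (fun y => tanProj M y v) ((projDeriv M x).flip v) M x :=
    hM.hasFDerivWithinAt_tanProj_apply hx
  have hPx : ∀ j, tanProj M x (τ j) = τ j := fun j => tanProj_eq_self (τ j).2
  have hb : HasFDerivWithinAt (fun y => fun i j => inner ℝ (tanProj M y (τ i)) (τ j : Euc N))
      (ContinuousLinearMap.pi fun i => ContinuousLinearMap.pi fun j =>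
        (innerSL ℝ (τ j : Euc N)).comp ((projDeriv M x).flip (τ i))) M x := by
    refine hasFDerivWithinAt_pi.2 fun i => hasFDerivWithinAt_pi.2 fun j => ?_
    have h := (innerSL ℝ (τ j : Euc N)).hasFDerivAt.comp_hasFDerivWithinAt x (hP (τ i))
    simp only [Function.comp_def, innerSL_apply_apply] at h
    simpa only [real_inner_comm (τ j : Euc N)] using h
  have hg := ((differentiable_det m) _).hasFDerivAt.comp_hasFDerivWithinAt x hb
  simp only [Function.comp_def] at hg
  have hgx : (Matrix.of fun i j => inner ℝ (tanProj M x (τ i)) (τ j : Euc N)).det = 1 := by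
    have : (Matrix.of fun i j => inner ℝ (tanProj M x (τ i)) (τ j : Euc N)) = 1 := by
      ext i j
      rw [Matrix.of_apply, hPx, orthonormal_iff_ite.1 (orthonormal_coe τ) i j, Matrix.one_apply]
    rw [this, Matrix.det_one]
  obtain ⟨L, hL, hL'⟩ := hasFDerivAt_ιMulti fun j => tanProj M x (τ j)
  have hG := hL.comp_hasFDerivWithinAt x (hasFDerivWithinAt_pi.2 fun j => hP (τ j))
  simp only [Function.comp_def] at hG
  -- The value of this derivative is irrelevant: it multiplies the derivative of the Gram
  -- determinant, which vanishes in tangent directions because `P'_a τ_i` is normal.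
  have hs : HasDerivAt (fun t : ℝ => (√t)⁻¹) (deriv (fun t : ℝ => (√t)⁻¹) 1) 1 := by
    refine DifferentiableAt.hasDerivAt ?_
    exact ((Real.hasDerivAt_sqrt one_ne_zero).differentiableAt).inv (by simp)
  rw [← hgx] at hs
  have hS := (hs.comp_hasFDerivWithinAt x hg).smul hG
  refine ⟨_, hS.congr_of_eventuallyEq (hT.eventually_eq hM hx τ hτ) ?_, fun a ha => ?_⟩
  · simp only [Function.comp_def, Pi.smul_apply']
    rw [hgx, hτ]
    simp [hPx]
  · have h0 : (ContinuousLinearMap.pi fun i => ContinuousLinearMap.pi fun j =>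
        (innerSL ℝ (τ j : Euc N)).comp ((projDeriv M x).flip (τ i) : Euc N →L[ℝ] Euc N)) a =
          (0 : Fin m → Fin m → ℝ) := by
      funext i j
      exact hM.inner_projDeriv hx ha (τ i).2 (τ j).2
    have h1 : L (fun j => projDeriv M x a (τ j)) = ∑ k, vec N (projDeriv M x a (τ k)) *
        vecContract N (τ k) (T x) := by
      rw [hL', hτ]
      refine Finset.sum_congr rfl fun k _ => ?_
      simp only [hPx]
      exact ιMulti_update_eq (orthonormal_coe τ) (hM.inner_projDeriv hx ha (τ k).2 (τ k).2)
    simp only [add_apply, smul_apply, ContinuousLinearMap.comp_apply,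
      ContinuousLinearMap.smulRight_apply, h0, map_zero, Function.comp_def, hgx]
    rw [← h1]
    simp

theorem IsGaussMap.differentiableWithinAt (hM : IsSmoothSubmanifold m M)
    (hT : IsGaussMap m M T) (hx : x ∈ M) : DifferentiableWithinAt ℝ T M x := by
  obtain ⟨τ, hτ⟩ := hT.eq_blade x hx
  obtain ⟨T', hT', -⟩ := hT.exists_hasFDerivWithinAt hM hx τ hτ
  exact hT'.differentiableWithinAt

theorem IsGaussMap.dirDeriv_eq (hM : IsSmoothSubmanifold m M)
    (hT : IsGaussMap m M T) (hx : x ∈ M) {a : Euc N} (ha : a ∈ tangentSpace M x) :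
    dirDeriv M T x a = ∑ k, vec N (projDeriv M x a (frame M x k)) *
      vecContract N (frame M x k) (T x) := by
  obtain ⟨τ, hτ⟩ := hT.eq_blade x hx
  obtain ⟨T', hT', h⟩ := hT.exists_hasFDerivWithinAt hM hx τ hτ
  rw [GaussMap.dirDeriv_eq hT' ha, h a ha]
  -- The sum is a trace, so the basis `τ` indexed by `Fin m` can be traded for the chosen frame,
  -- indexed by the dimension of `T_x M`.
  exact sum_bilin_eq_sum_bilin τ (frame M x)
    ((LinearMap.mul ℝ (Multivector N)).compl₁₂ ((vec N).comp (projDeriv M x a).toLinearMap)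
      ((vecContract N).flip (T x)))

end GaussMapDerivative

/-! ### Divergence, curl and graded Laplacian under the Hodge dual. -/

section DiracOperator

variable {N : ℕ} {M : Set (Euc N)} {F G : Euc N → Multivector N} {x : Euc N}

theorem divergence_congr (h : ∀ y ∈ M, F y = G y) (hx : x ∈ M) :
    divergence M F x = divergence M G x := by
  simp only [divergence, dirDeriv_congr h hx]

theorem curl_congr (h : ∀ y ∈ M, F y = G y) (hx : x ∈ M) : curl M F x = curl M G x := by
  simp only [curl, dirDeriv_congr h hx]

theorem curl_eq_zero_of_eq_zero (h : ∀ y ∈ M, F y = 0) (hx : x ∈ M) : curl M F x = 0 := by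
  rw [curl_congr h hx]
  simp [curl, dirDeriv]

theorem dirDeriv_linearMap_comp {V W : Type*} [NormedAddCommGroup V] [NormedSpace ℝ V]
    [NormedAddCommGroup W] [NormedSpace ℝ W] [FiniteDimensional ℝ V] (L : V →ₗ[ℝ] W)
    {F : Euc N → V} {a : Euc N} (hF : DifferentiableWithinAt ℝ F M x)
    (ha : a ∈ tangentSpace M x) : dirDeriv M (fun y => L (F y)) x a = L (dirDeriv M F x a) :=
  dirDeriv_clm_comp L.toContinuousLinearMap hF ha

theorem differentiableWithinAt_linearMap_comp {V W : Type*} [NormedAddCommGroup V]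
    [NormedSpace ℝ V] [NormedAddCommGroup W] [NormedSpace ℝ W] [FiniteDimensional ℝ V]
    (L : V →ₗ[ℝ] W) {F : Euc N → V} (hF : DifferentiableWithinAt ℝ F M x) :
    DifferentiableWithinAt ℝ (fun y => L (F y)) M x :=
  L.toContinuousLinearMap.differentiableAt.comp_differentiableWithinAt x hF

theorem hasFDerivWithinAt_mul {F' G' : Euc N →L[ℝ] Multivector N}
    (hF : HasFDerivWithinAt F F' M x) (hG : HasFDerivWithinAt G G' M x) :
    ∃ L : Euc N →L[ℝ] Multivector N, HasFDerivWithinAt (fun y => F y * G y) L M x ∧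
      ∀ a, L a = F x * G' a + F' a * G x :=
  ⟨_, (LinearMap.mul ℝ (Multivector N)).toContinuousBilinearMap.hasFDerivWithinAt_of_bilinear
    hF hG, fun _ => rfl⟩

theorem curl_gradeInvol (hF : DifferentiableWithinAt ℝ F M x) :
    curl M (fun y => gradeInvol N (F y)) x = -gradeInvol N (curl M F x) := by
  unfold curl
  rw [map_sum, ← Finset.sum_neg_distrib]
  refine Finset.sum_congr rfl fun j _ => ?_
  have h := dirDeriv_linearMap_comp (gradeInvol N).toLinearMap hF (frame M x j).2
  simp only [AlgHom.toLinearMap_apply] at h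
  rw [h, map_mul, gradeInvol_vec, neg_mul, neg_neg]

theorem divergence_hodge (hF : DifferentiableWithinAt ℝ F M x) :
    divergence M (fun y => hodge N (F y)) x = hodge N (-gradeInvol N (curl M F x)) := by
  unfold divergence curl
  rw [map_sum, ← Finset.sum_neg_distrib, map_sum]
  refine Finset.sum_congr rfl fun j _ => ?_
  rw [dirDeriv_linearMap_comp (hodge N) hF (frame M x j).2, vecContract_hodge,
    map_mul (gradeInvol N), gradeInvol_vec, neg_mul, neg_neg]

theorem curl_hodge (hF : DifferentiableWithinAt ℝ F M x) :
    curl M (fun y => hodge N (F y)) x = hodge N (gradeInvol N (divergence M F x)) := by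
  unfold divergence curl
  rw [map_sum, map_sum]
  refine Finset.sum_congr rfl fun j _ => ?_
  rw [dirDeriv_linearMap_comp (hodge N) hF (frame M x j).2, vec_mul_hodge,
    gradeInvol_vecContract, map_neg]

/-- The graded Laplace operator commutes with the Hodge dual. -/
theorem gradedLaplacian_hodge (hF : ∀ y ∈ M, DifferentiableWithinAt ℝ F M y)
    (hc : ∀ y ∈ M, DifferentiableWithinAt ℝ (curl M F) M y)
    (hd : ∀ y ∈ M, DifferentiableWithinAt ℝ (divergence M F) M y) (hx : x ∈ M) :
    gradedLaplacian M (fun y => hodge N (F y)) x = hodge N (gradedLaplacian M F x) := by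
  have hd' := differentiableWithinAt_linearMap_comp (gradeInvol N).toLinearMap (hd x hx)
  have hc' := differentiableWithinAt_linearMap_comp (-(gradeInvol N).toLinearMap) (hc x hx)
  simp only [AlgHom.toLinearMap_apply, LinearMap.neg_apply] at hd' hc'
  have hcn : divergence M (fun y => -gradeInvol N (curl M F y)) x =
      gradeInvol N (divergence M (curl M F) x) := by
    unfold divergence
    rw [map_sum]
    refine Finset.sum_congr rfl fun j _ => ?_
    have h := dirDeriv_linearMap_comp (-(gradeInvol N).toLinearMap) (hc x hx) (frame M x j).2
    simp only [AlgHom.toLinearMap_apply, LinearMap.neg_apply] at h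
    rw [h, map_neg, gradeInvol_vecContract]
  unfold gradedLaplacian
  rw [divergence_congr (fun y hy => curl_hodge (hF y hy)) hx,
    curl_congr (fun y hy => divergence_hodge (hF y hy)) hx, divergence_hodge hd', curl_hodge hc',
    curl_gradeInvol (hd x hx), hcn, map_neg (gradeInvol N), map_neg (hodge N),
    map_neg (hodge N), neg_neg,
    gradeInvol_gradeInvol, gradeInvol_gradeInvol, map_add, add_comm]

end DiracOperator

/-! ### Graded Laplacian of the Gauss map and the equivalence. -/

section Main

variable {N m : ℕ} {M : Set (Euc N)} {T : Euc N → Multivector N} {x : Euc N}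

/-- Moving `τ_j` past `II(τ_j, τ_k)` gives a sign, and `τ_j ∧ (τ_k ⌟ T) = δ_jk T` leaves the trace
of `II`. -/
theorem IsGaussMap.curl_eq (hM : IsSmoothSubmanifold m M) (hT : IsGaussMap m M T) (hx : x ∈ M) :
    curl M T x = -(vec N (meanCurvature M x) * T x) := by
  unfold curl
  rw [hM.meanCurvature_eq hx, map_sum, Finset.sum_mul, ← Finset.sum_neg_distrib]
  refine Finset.sum_congr rfl fun j _ => ?_
  rw [hT.dirDeriv_eq hM hx (frame M x j).2, Finset.mul_sum, Finset.sum_eq_single j]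
  · rw [vec_mul_vec_mul_comm, hT.vec_mul_vecContract hx (frame M x j).2,
      orthonormal_iff_ite.1 (orthonormal_coe (frame M x)) j j, if_pos rfl, one_smul]
  · intro k _ hk
    rw [vec_mul_vec_mul_comm, hT.vec_mul_vecContract hx (frame M x j).2,
      orthonormal_iff_ite.1 (orthonormal_coe (frame M x)) k j, if_neg hk, zero_smul, mul_zero,
      neg_zero]
  · simp

/-- `II(τ_j, τ_k)` is normal, so `τ_j` contracts only `τ_k ⌟ T`; then `II` is symmetric and the
double contraction antisymmetric in `j`, `k`. -/
theorem IsGaussMap.divergence_eq_zero (hM : IsSmoothSubmanifold m M) (hT : IsGaussMap m M T)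
    (hx : x ∈ M) : divergence M T x = 0 := by
  unfold divergence
  have h : ∀ j, vecContract N (frame M x j) (dirDeriv M T x (frame M x j)) =
      ∑ k, -(vec N (projDeriv M x (frame M x j) (frame M x k)) *
        vecContract N (frame M x j) (vecContract N (frame M x k) (T x))) := by
    intro j
    rw [hT.dirDeriv_eq hM hx (frame M x j).2, map_sum]
    refine Finset.sum_congr rfl fun k _ => ?_
    rw [vecContract_vec_mul, hM.inner_projDeriv hx (frame M x j).2 (frame M x k).2
      (frame M x j).2, zero_smul, zero_sub]
  simp only [h]
  refine sum_sum_smul_eq_zero fun j k => ?_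
  rw [vecContract_comm, hM.projDeriv_comm hx (frame M x k).2 (frame M x j).2, mul_neg]

theorem IsGaussMap.differentiableWithinAt_curl (hM : IsSmoothSubmanifold m M)
    (hT : IsGaussMap m M T) (hx : x ∈ M) : DifferentiableWithinAt ℝ (curl M T) M x := by
  have hH := differentiableWithinAt_linearMap_comp (vec N)
    (hM.differentiableWithinAt_meanCurvature hx)
  obtain ⟨L, hL, -⟩ := hasFDerivWithinAt_mul hH.hasFDerivWithinAt
    (hT.differentiableWithinAt hM hx).hasFDerivWithinAt
  exact hL.differentiableWithinAt.neg.congr (fun y hy => hT.curl_eq hM hy) (hT.curl_eq hM hx)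

theorem IsGaussMap.gradedLaplacian_eq (hM : IsSmoothSubmanifold m M) (hT : IsGaussMap m M T)
    (hx : x ∈ M) : gradedLaplacian M T x =
      ∑ j, (vec N (dirDeriv M (meanCurvature M) x (frame M x j)) *
          vecContract N (frame M x j) (T x) -
        inner ℝ (frame M x j : Euc N) (dirDeriv M (meanCurvature M) x (frame M x j)) • T x) := by
  have hH := hM.differentiableWithinAt_meanCurvature hx
  have hH' := differentiableWithinAt_linearMap_comp (vec N) hH
  have hTd := hT.differentiableWithinAt hM hx
  obtain ⟨L, hL, hLa⟩ := hasFDerivWithinAt_mul hH'.hasFDerivWithinAt hTd.hasFDerivWithinAt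
  have hd : ∀ a ∈ tangentSpace M x,
      dirDeriv M (fun y => -(vec N (meanCurvature M y) * T y)) x a =
        -(vec N (meanCurvature M x) * dirDeriv M T x a +
          vec N (dirDeriv M (meanCurvature M) x a) * T x) := by
    intro a ha
    rw [GaussMap.dirDeriv_eq hL.fun_neg ha, ← dirDeriv_linearMap_comp (vec N) hH ha]
    exact congrArg Neg.neg (hLa a)
  unfold gradedLaplacian
  rw [curl_eq_zero_of_eq_zero (fun y hy => hT.divergence_eq_zero hM hy) hx, add_zero,
    divergence_congr (fun y hy => hT.curl_eq hM hy) hx]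
  have hdiv := hT.divergence_eq_zero hM hx
  unfold divergence at hdiv ⊢
  -- The terms from `H ∧ D_j T` add up to `H ∧ (∂ ⌟ T) = 0`, as `H` is normal.
  have h0 := congrArg (vec N (meanCurvature M x) * ·) hdiv
  simp only [Finset.mul_sum, mul_zero] at h0
  refine Eq.trans ?_ (add_eq_left.2 h0)
  rw [← Finset.sum_add_distrib]
  refine Finset.sum_congr rfl fun j _ => ?_
  rw [hd _ (frame M x j).2, map_neg, map_add, vecContract_vec_mul, vecContract_vec_mul,
    hM.inner_meanCurvature hx (frame M x j).2, zero_smul]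
  abel

/-- With `K = T_x M`, the tangential parts of `w` cancel in `∑ τ_j ∧ w_j` if they are symmetric. -/
theorem sum_vec_mul_vec_eq_zero_iff {ι : Type*} [Fintype ι] {K : Submodule ℝ (Euc N)}
    (b : OrthonormalBasis ι ℝ K) {w : ι → Euc N}
    (hw : ∀ j k, inner ℝ (b k : Euc N) (w j) = inner ℝ (b j : Euc N) (w k)) :
    ∑ j, vec N (b j) * vec N (w j) = 0 ↔ ∀ j, w j ∈ K := by
  have hexp : ∀ j, w j ∈ K → w j = ∑ k, inner ℝ (b k : Euc N) (w j) • (b k : Euc N) := by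
    intro j hj
    have h := congrArg (Submodule.subtype _) (b.sum_repr ⟨w j, hj⟩)
    simp only [map_sum, map_smul, Submodule.subtype_apply, b.repr_apply_apply] at h
    exact h.symm
  constructor
  · intro h k
    -- Contracting by `b_k` yields `w_k = ∑ ⟪b_k, w_j⟫ b_j`, which lies in `K`.
    have h1 := congrArg (vecContract N (b k)) h
    rw [map_sum, map_zero] at h1
    simp only [vecContract_vec_mul, vecContract_vec, Finset.sum_sub_distrib] at h1
    classical
    simp only [orthonormal_iff_ite.1 (orthonormal_coe b), ite_smul, one_smul, zero_smul,
      Finset.sum_ite_eq, Finset.mem_univ, if_true, Algebra.algebraMap_eq_smul_one,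
      mul_smul_comm, mul_one, ← map_smul, ← map_sum, ← map_sub] at h1
    have h2 := (ExteriorAlgebra.ι_eq_zero_iff _).1 h1
    rw [sub_eq_zero.1 h2]
    exact K.sum_mem fun j _ => K.smul_mem _ (b j).2
  · intro h
    have h1 : ∀ j, vec N (b j) * vec N (w j) = ∑ k, inner ℝ (b k : Euc N) (w j) •
        (vec N (b j) * vec N (b k)) := by
      intro j
      conv_lhs => rw [hexp j (h j)]
      rw [map_sum, Finset.mul_sum]
      exact Finset.sum_congr rfl fun k _ => by rw [map_smul, mul_smul_comm]
    simp only [h1]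
    refine sum_sum_smul_eq_zero fun j k => ?_
    rw [hw, vec_mul_vec_comm, smul_neg]

/-- Only the normal parts `n_j` of `w_j` survive, as `a ∧ (b_j ⌟ T) = ⟪b_j, a⟫ T` for tangent `a`.
Wedging with `b_k` isolates `n_k ∧ T = 0`, and contracting by `n_k` gives `‖n_k‖² T = 0`. -/
theorem IsGaussMap.sum_vec_mul_vecContract_eq_zero_iff (hT : IsGaussMap m M T) (hx : x ∈ M)
    {ι : Type*} [Fintype ι] (b : OrthonormalBasis ι ℝ (tangentSpace M x)) {w : ι → Euc N} :
    ∑ j, (vec N (w j) * vecContract N (b j) (T x) - inner ℝ (b j : Euc N) (w j) • T x) = 0 ↔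
      ∀ j, w j ∈ tangentSpace M x := by
  classical
  constructor
  · intro h k
    set n : ι → Euc N := fun j => w j - tanProj M x (w j) with hn
    have hort : ∀ j, ∀ a ∈ tangentSpace M x, inner ℝ (n j) a = 0 := by
      intro j a ha
      rw [hn, inner_sub_left, tanProj_inner, tanProj_eq_self ha, sub_self]
    have h1 : ∑ j, vec N (n j) * vecContract N (b j) (T x) = 0 := by
      rw [← h]
      refine Finset.sum_congr rfl fun j _ => ?_
      rw [hn, map_sub, sub_mul, hT.vec_mul_vecContract hx (tanProj_mem x _), ← tanProj_inner,
        tanProj_eq_self (b j).2]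
    have h2 := congrArg (vec N (b k) * ·) h1
    simp only [Finset.mul_sum, mul_zero] at h2
    rw [Finset.sum_eq_single k] at h2
    · rw [vec_mul_vec_mul_comm, hT.vec_mul_vecContract hx (b k).2,
        orthonormal_iff_ite.1 (orthonormal_coe b) k k, if_pos rfl, one_smul, neg_eq_zero] at h2
      have h3 := vecContract_vec_mul (n k) (n k) (T x)
      rw [h2, map_zero, hT.vecContract_eq_zero hx (hort k), mul_zero, sub_zero] at h3
      have h4 := (smul_eq_zero.1 h3.symm).resolve_right (hT.ne_zero hx)
      rw [sub_eq_zero.1 (inner_self_eq_zero.1 h4)]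
      exact tanProj_mem x _
    · intro j _ hj
      rw [vec_mul_vec_mul_comm, hT.vec_mul_vecContract hx (b k).2,
        orthonormal_iff_ite.1 (orthonormal_coe b) j k, if_neg hj, zero_smul, mul_zero, neg_zero]
    · simp
  · intro h
    refine Finset.sum_eq_zero fun j _ => ?_
    rw [hT.vec_mul_vecContract hx (h j), sub_self]

/-- Both conditions say that every derivative of `H` along the frame is tangent to `M`. -/
theorem IsGaussMap.curl_meanCurvature_eq_zero_iff (hM : IsSmoothSubmanifold m M)
    (hT : IsGaussMap m M T) (hx : x ∈ M) :
    curl M (fun y => vec N (meanCurvature M y)) x = 0 ↔ gradedLaplacian M T x = 0 := by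
  rw [hT.gradedLaplacian_eq hM hx, hT.sum_vec_mul_vecContract_eq_zero_iff hx (frame M x),
    ← sum_vec_mul_vec_eq_zero_iff (frame M x) fun j k =>
      hM.inner_dirDeriv_meanCurvature_comm hx (frame M x j).2 (frame M x k).2]
  unfold curl
  simp only [fun j => dirDeriv_linearMap_comp (vec N)
    (hM.differentiableWithinAt_meanCurvature hx) (frame M x j).2]

theorem IsGaussMap.gradedLaplacian_normalGaussMap (hM : IsSmoothSubmanifold m M)
    (hT : IsGaussMap m M T) (hx : x ∈ M) :
    gradedLaplacian M (normalGaussMap T) x = hodge N (gradedLaplacian M T x) := by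
  refine gradedLaplacian_hodge (fun y hy => hT.differentiableWithinAt hM hy)
    (fun y hy => hT.differentiableWithinAt_curl hM hy) (fun y hy => ?_) hx
  exact (differentiableWithinAt_const 0).congr (fun z hz => hT.divergence_eq_zero hM hz)
    (hT.divergence_eq_zero hM hy)

end Main

end GaussMap

end

theorem mainTheorem3 (N m : ℕ) (M : Set (GaussMap.Euc N))
    (hM : GaussMap.IsSmoothSubmanifold m M)
    (T : GaussMap.Euc N → GaussMap.Multivector N) (hT : GaussMap.IsGaussMap m M T) :
    (GaussMap.IsCurlFree M (fun x => GaussMap.vec N (GaussMap.meanCurvature M x)) ↔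
      GaussMap.IsGradedHarmonic M T) ∧
    (GaussMap.IsCurlFree M (fun x => GaussMap.vec N (GaussMap.meanCurvature M x)) ↔
      GaussMap.IsGradedHarmonic M (GaussMap.normalGaussMap T)) := by
  refine ⟨forall₂_congr fun x hx => hT.curl_meanCurvature_eq_zero_iff hM hx,
    forall₂_congr fun x hx => ?_⟩
  rw [hT.gradedLaplacian_normalGaussMap hM hx, map_eq_zero_iff _ (GaussMap.hodge_injective N)]
  exact hT.curl_meanCurvature_eq_zero_iff hM hx
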